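/- For an integer $m\ge 1$ let $J_{2m}$ be the graph with vertex set $\{x_i,y_i : 0\le i\le m+1\}$ (these $2m+4$ vertices are distinct) and edges $\{x_i,y_i\}$ for $1\le i\le m$, together with $\{x_i,x_{i+1}\}$, $\{y_i,y_{i+1}\}$, $\{x_i,y_{i+1}\}$, $\{y_i,x_{i+1}\}$, $\{x_i,x_{i+2}\}$, $\{y_i,y_{i+2}\}$, $\{x_i,y_{i+2}\}$, $\{y_i,x_{i+2}\}$ for $0\le i\le m-1$. Let $J_{2m}^*$ be the digraph obtained from $J_{2m}$ by replacing each edge $\{u,v\}$ with the two arcs $uv$ and $vu$. Denote by $[m_1,\dots,m_t]$ (with every $m_j\ge 2$) the digraph that is the vertex-disjoint union of directed cycles of lengths $m_1,\dots,m_t$; such digraphs are called $2$-regular, and $2^2$ inside the brackets stands for two cycles of length $2$. A $2$-regular subdigraph of $J_{2m}^*$ is *admissible* if it has exactly $2m$ vertices and contains exactly one vertex from each of the sets $\{x_0,x_m\}$, $\{x_1,x_{m+1}\}$, $\{y_0,y_m\}$, $\{y_1,y_{m+1}\}$. An *admissible $F$-decomposition* of $J_{2m}^*$ is a list $(F_1,\dots,F_9)$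 of pairwise arc-disjoint admissible $2$-regular subdigraphs, each isomorphic to $F$, whose arc sets have union the arc set of $J_{2m}^*$. Its *external pattern* is the list whose $i$-th entry is $\{x_0,x_1,y_0,y_1\}\cap V(F_i)$. Let $$\mathcal X=(\{y_1\},\{x_0,x_1,y_1\},\{x_1,y_0,y_1\},\{x_0,x_1,y_0,y_1\},\{y_1\},\{x_0,x_1,y_0\},\{x_1,y_1\},\{x_1\},\{x_0,x_1,y_0,y_1\}).$$ **Lemma.** Let $F$ be a $2$-regular digraph of order $2m$. There exists an admissible $F$-decomposition of $J_{2m}^*$ with external pattern $\mathcal X$ in each of the following cases: 1. $F=[2s]$ with $s\ge 4$; 2. $F=[2s,2]$ with $s\ge 4$; 3. $F=[2s,2^2]$ with $s\ge 4$; 4. $F=[2s,4]$ with $s\ge 5$. -/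

import Mathlib

namespace DirectedOberwolfach

/-- The symbols `x_i` and `y_i`, `i = 0, 1, 2, …`, used as vertices. -/
inductive Vertex where
  | x (i : ℕ)
  | y (i : ℕ)
  deriving DecidableEq

/-- The index `i` of a vertex `x_i` or `y_i`. -/
def Vertex.index : Vertex → ℕ
  | .x i => i
  | .y i => i

open Vertex

/-- A directed graph (no parallel arcs) with a specified vertex set inside the type `V`. -/
@[ext]
structure VDigraph (V : Type*) where
  /-- the vertex set -/
  verts : Set V
  /-- `Arc u v` says that `uv` is an arc -/
  Arc : V → V → Prop
  source_mem : ∀ {u v}, Arc u v → u ∈ verts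
  target_mem : ∀ {u v}, Arc u v → v ∈ verts

/-- `H` is a subdigraph of `G`. -/
def VDigraph.IsSubdigraph {V : Type*} (H G : VDigraph V) : Prop :=
  H.verts ⊆ G.verts ∧ ∀ u v, H.Arc u v → G.Arc u v

/-- The vertices `x_i`, `y_i`, `0 ≤ i ≤ m + 1`, of the graph `J_{2m}`. -/
def JVerts (m : ℕ) : Set Vertex := {v | v.index ≤ m + 1}

/-- The edge set of the (undirected) graph `J_{2m}`. -/
def JEdges (m : ℕ) : Set (Sym2 Vertex) :=
  {e | ∃ i, 1 ≤ i ∧ i ≤ m ∧ e = s(x i, y i)} ∪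
  {e | ∃ i, i < m ∧
    (e = s(x i, x (i + 1)) ∨ e = s(y i, y (i + 1)) ∨
     e = s(x i, y (i + 1)) ∨ e = s(y i, x (i + 1)) ∨
     e = s(x i, x (i + 2)) ∨ e = s(y i, y (i + 2)) ∨
     e = s(x i, y (i + 2)) ∨ e = s(y i, x (i + 2)))}

theorem mem_JVerts_of_mem_JEdges {m : ℕ} {e : Sym2 Vertex} (he : e ∈ JEdges m) {v : Vertex}
    (hv : v ∈ e) : v ∈ JVerts m := by
  simp only [JVerts, Set.mem_ofPred_eq]
  rcases he with ⟨i, h1, h2, rfl⟩ | ⟨i, h, h'⟩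
  · rcases Sym2.mem_iff.1 hv with rfl | rfl <;> simp only [index] <;> omega
  · rcases h' with rfl | rfl | rfl | rfl | rfl | rfl | rfl | rfl <;>
      rcases Sym2.mem_iff.1 hv with rfl | rfl <;> simp only [index] <;> omega

/-- The digraph `J_{2m}^*`: each edge `{u, v}` of `J_{2m}` is replaced with the arcs `uv`, `vu`. -/
def Jstar (m : ℕ) : VDigraph Vertex where
  verts := JVerts m
  Arc u v := s(u, v) ∈ JEdges m
  source_mem h := mem_JVerts_of_mem_JEdges h (Sym2.mem_mk_left _ _)
  target_mem h := mem_JVerts_of_mem_JEdges h (Sym2.mem_mk_right _ _)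

/-- The digraph `[m_1, …, m_t]`: the vertex-disjoint union of directed cycles of lengths
`m_1, …, m_t`, the `j`-th cycle having vertices `0, …, m_j - 1` and arcs `a → a + 1 (mod m_j)`.
It is used for `m_j ≥ 2` only. -/
def disjointCycles (F : List ℕ) : Digraph (Σ j : Fin F.length, Fin (F.get j)) where
  Adj u v := u.1 = v.1 ∧ (v.2 : ℕ) = ((u.2 : ℕ) + 1) % F.get u.1

/-- `H` is isomorphic, as a digraph, to `[m_1, …, m_t]`. -/
def VDigraph.IsOfType {V : Type*} (H : VDigraph V) (F : List ℕ) : Prop :=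
  Nonempty ((fun u v : H.verts => H.Arc u v) ≃r (disjointCycles F).Adj)

/-- A 2-regular digraph: a vertex-disjoint union of (finitely many) directed cycles. -/
def VDigraph.IsTwoRegular {V : Type*} (H : VDigraph V) : Prop :=
  ∃ F : List ℕ, (∀ n ∈ F, 2 ≤ n) ∧ H.IsOfType F

/-- `H` is an admissible 2-regular subdigraph of `J_{2m}^*`. -/
structure IsAdmissible (m : ℕ) (H : VDigraph Vertex) : Prop where
  isSubdigraph : H.IsSubdigraph (Jstar m)
  isTwoRegular : H.IsTwoRegular
  order_eq : H.verts.ncard = 2 * m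
  x_zero : Xor (x 0 ∈ H.verts) (x m ∈ H.verts)
  x_one : Xor (x 1 ∈ H.verts) (x (m + 1) ∈ H.verts)
  y_zero : Xor (y 0 ∈ H.verts) (y m ∈ H.verts)
  y_one : Xor (y 1 ∈ H.verts) (y (m + 1) ∈ H.verts)

/-- The subdigraphs `D i` of `G` decompose `G`: they are pairwise arc-disjoint and
their arc sets have union the arc set of `G`. -/
structure IsDecomposition {V ι : Type*} (G : VDigraph V) (D : ι → VDigraph V) : Prop where
  isSubdigraph : ∀ i, (D i).IsSubdigraph G
  arc_disjoint : ∀ i j, i ≠ j → ∀ u v, ¬ ((D i).Arc u v ∧ (D j).Arc u v)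
  arc_union : ∀ u v, G.Arc u v ↔ ∃ i, (D i).Arc u v

/-- `(D_1, …, D_9)` is an admissible `F`-decomposition of `J_{2m}^*`. -/
structure IsAdmissibleDecomposition (m : ℕ) (F : List ℕ) (D : Fin 9 → VDigraph Vertex) :
    Prop where
  isDecomposition : IsDecomposition (Jstar m) D
  isAdmissible : ∀ i, IsAdmissible m (D i)
  isOfType : ∀ i, (D i).IsOfType F

/-- The external pattern of a list of nine subdigraphs of `J_{2m}^*`. -/
def externalPattern (D : Fin 9 → VDigraph Vertex) : Fin 9 → Set Vertex :=
  fun i => {x 0, x 1, y 0, y 1} ∩ (D i).verts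

/-- The fixed external pattern `𝒳`. -/
def patternX : Fin 9 → Set Vertex :=
  ![{y 1}, {x 0, x 1, y 1}, {x 1, y 0, y 1}, {x 0, x 1, y 0, y 1}, {y 1}, {x 0, x 1, y 0},
    {x 1, y 1}, {x 1}, {x 0, x 1, y 0, y 1}]

end DirectedOberwolfach

namespace DirectedOberwolfach

open Vertex

/-! ### Digraphs given by lists of cycles -/

/-! The arc set of `Jstar (p + n)` is the disjoint union of that of `Jstar p` and a copy of that of
`Jstar n` translated by `p` levels (`JArcs_add`), so a decomposition can be assembled from pieces
separated by cuts. The vertices of levels `p` and `p + 1` are incident with arcs of both pieces.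

Each `F_i` crosses every cut exactly twice, both times on its long cycle: to the right at a vertex
`entry i` and back to the left at `exit i`. The set `cutPattern i` prescribes which of the four
vertices at the cut `F_i` uses on the right-hand side; the left-hand side has to avoid these.
Because these data are the same at every cut, pieces fit together freely.

Three kinds of pieces suffice. The left piece has two levels and realizes the external pattern. The
periodic piece has two levels and adds four vertices to each long cycle, so it replaces `m` by `m +
2` and `2s` by `2s + 4`. The end piece contains all the short cycles, and on its last two levels it
uses exactly the translates of the vertices missing from the external pattern, which is
admissibility. For each type there are two end pieces, with `n` and `n + 1` levels, to reach both
parities of `m`.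

All combinatorial content is in finite tables verified by computation; the inductive step
`IsEnd.extend` and the closing step `IsEnd.exists_decomposition` glue them. -/

/-- The arcs of the directed path through the given vertices. -/
def pathArcs {V : Type*} (l : List V) : List (V × V) := l.zip l.tail

/-- The arcs of the directed cycle through the given vertices. -/
def cycleArcs {V : Type*} (l : List V) : List (V × V) := l.zip (l.rotate 1)

/-- A path may be cut at a vertex kept as an endpoint of both halves without losing an arc. All
gluing of arc lists rests on this. -/
theorem pathArcs_append_cons {V : Type*} (a : List V) (b : V) (c : List V) :
    pathArcs (a ++ b :: c) = pathArcs (a ++ [b]) ++ pathArcs (b :: c) := by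
  induction a with
  | nil => simp [pathArcs]
  | cons h t ih =>
    cases t with
    | nil => simp [pathArcs]
    | cons h' t' =>
      simp only [pathArcs, List.cons_append, List.tail_cons, List.zip_cons_cons] at ih ⊢
      rw [ih]

theorem cycleArcs_cons {V : Type*} (a : V) (t : List V) :
    cycleArcs (a :: t) = pathArcs (a :: t ++ [a]) := by
  have h : (a :: t).zip (t ++ [a]) = (a :: t ++ [a]).zip (t ++ [a] ++ []) := by
    rw [List.zip_append (by simp)]
    simp
  simpa [cycleArcs, pathArcs] using h

theorem pathArcs_map {V W : Type*} (f : V → W) (l : List V) :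
    pathArcs (l.map f) = (pathArcs l).map (Prod.map f f) := by
  simp [pathArcs, List.zip_map, ← List.map_tail]

theorem cycleArcs_map {V W : Type*} (f : V → W) (l : List V) :
    cycleArcs (l.map f) = (cycleArcs l).map (Prod.map f f) := by
  simp [cycleArcs, List.zip_map, ← List.map_rotate]

theorem mem_cycleArcs {V : Type*} {l : List V} {u v : V} :
    (u, v) ∈ cycleArcs l ↔ ∃ (k : ℕ) (h : k < l.length),
      u = l[k] ∧ v = l[(k + 1) % l.length]'(Nat.mod_lt _ (by omega)) := by
  simp only [cycleArcs, List.mem_iff_getElem, List.getElem_zip, List.getElem_rotate,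
    List.length_zip, List.length_rotate, min_self, Prod.mk.injEq]
  constructor
  · rintro ⟨k, h, rfl, rfl⟩
    exact ⟨k, h, rfl, rfl⟩
  · rintro ⟨k, h, rfl, rfl⟩
    exact ⟨k, h, rfl, rfl⟩

/-- The digraph consisting of the given directed cycles. -/
def ofCycles {V : Type*} (L : List (List V)) : VDigraph V where
  verts := {v | v ∈ L.flatten}
  Arc u v := (u, v) ∈ L.flatMap cycleArcs
  source_mem h := by
    obtain ⟨c, hc, h⟩ := List.mem_flatMap.1 h
    exact List.mem_flatten.2 ⟨c, hc, (List.of_mem_zip h).1⟩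
  target_mem h := by
    obtain ⟨c, hc, h⟩ := List.mem_flatMap.1 h
    exact List.mem_flatten.2 ⟨c, hc, List.mem_rotate.1 (List.of_mem_zip h).2⟩

/-- The isomorphism sends position `k` of cycle `j` to the vertex `L[j][k]`; the absence of
repetitions in `L.flatten` makes it injective and lets an arc determine its cycle and position. -/
theorem ofCycles_isOfType {V : Type*} {L : List (List V)} {F : List ℕ}
    (hF : L.map List.length = F) (hL : L.flatten.Nodup) : (ofCycles L).IsOfType F := by
  subst hF
  obtain ⟨hnd, hdisj⟩ := List.nodup_flatten.1 hL
  have hj (j : Fin (L.map List.length).length) : (j : ℕ) < L.length := by simpa using j.2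
  have hk (a : Σ j : Fin (L.map List.length).length, Fin ((L.map List.length).get j)) :
      (a.2 : ℕ) < (L[(a.1 : ℕ)]'(hj a.1)).length := by
    simpa using a.2.2
  let f (a : Σ j : Fin (L.map List.length).length, Fin ((L.map List.length).get j)) : V :=
    (L[(a.1 : ℕ)]'(hj a.1))[(a.2 : ℕ)]'(hk a)
  have hcyc {j j' : ℕ} (h : j < L.length) (h' : j' < L.length) {v : V} (hv : v ∈ L[j])
      (hv' : v ∈ L[j']) : j = j' := by
    by_contra hne
    rcases Nat.lt_or_gt_of_ne hne with hlt | hlt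
    · exact List.pairwise_iff_getElem.1 hdisj j j' h h' hlt hv hv'
    · exact List.pairwise_iff_getElem.1 hdisj j' j h' h hlt hv' hv
  have hinj : Function.Injective f := by
    rintro ⟨⟨j, h1⟩, ⟨k, h2⟩⟩ ⟨⟨j', h1'⟩, ⟨k', h2'⟩⟩ h
    have e : j = j' := hcyc (hj ⟨j, h1⟩) (hj ⟨j', h1'⟩) (List.getElem_mem _)
      (by rw [show (L[j]'(hj ⟨j, h1⟩))[k]'(hk ⟨⟨j, h1⟩, ⟨k, h2⟩⟩) = _ from h]
          exact List.getElem_mem _)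
    subst e
    have : k = k' := ((hnd _ (List.getElem_mem (hj ⟨j, h1⟩))).getElem_inj_iff).1 h
    subst this
    rfl
  have hmem (a) : f a ∈ (ofCycles L).verts :=
    List.mem_flatten.2 ⟨_, List.getElem_mem _, List.getElem_mem _⟩
  let g (a : Σ j : Fin (L.map List.length).length, Fin ((L.map List.length).get j)) :
      (ofCycles L).verts := ⟨f a, hmem a⟩
  have hg : Function.Bijective g := by
    refine ⟨fun a b h => hinj (congrArg Subtype.val h), ?_⟩
    rintro ⟨v, hv⟩
    obtain ⟨c, hc, hv⟩ := List.mem_flatten.1 hv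
    obtain ⟨j, h, rfl⟩ := List.mem_iff_getElem.1 hc
    obtain ⟨k, h', rfl⟩ := List.mem_iff_getElem.1 hv
    exact ⟨⟨⟨j, by simpa using h⟩, ⟨k, by simpa using h'⟩⟩, rfl⟩
  refine ⟨(RelIso.mk (Equiv.ofBijective g hg) ?_).symm⟩
  rintro ⟨⟨j, h1⟩, ⟨k, h2⟩⟩ ⟨⟨j', h1'⟩, ⟨k', h2'⟩⟩
  have hjL : j < L.length := by simpa using h1
  have hjL' : j' < L.length := by simpa using h1'
  have h2L : k < L[j].length := by simpa using h2
  have h2L' : k' < L[j'].length := by simpa using h2'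
  change (L[j][k], L[j'][k']) ∈ L.flatMap cycleArcs ↔
    (⟨j, h1⟩ : Fin _) = ⟨j', h1'⟩ ∧ k' = (k + 1) % (L.map List.length).get ⟨j, h1⟩
  simp only [List.mem_flatMap, mem_cycleArcs, Fin.mk.injEq, List.get_eq_getElem,
    List.getElem_map]
  constructor
  · rintro ⟨c, hc, k₁, hk₁, e₁, e₂⟩
    obtain ⟨i, hi, rfl⟩ := List.mem_iff_getElem.1 hc
    obtain rfl := hcyc hjL hi (List.getElem_mem h2L) (e₁ ▸ List.getElem_mem _)
    obtain rfl := hcyc hjL' hi (List.getElem_mem h2L') (e₂ ▸ List.getElem_mem _)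
    have hn := hnd _ (List.getElem_mem hi)
    have := hn.getElem_inj_iff.1 e₁
    subst this
    exact ⟨rfl, hn.getElem_inj_iff.1 e₂⟩
  · rintro ⟨rfl, rfl⟩
    exact ⟨_, List.getElem_mem hjL, k, h2L, rfl, rfl⟩

theorem ncard_verts_ofCycles {V : Type*} {L : List (List V)} (hL : L.flatten.Nodup) :
    (ofCycles L).verts.ncard = (L.map List.length).sum := by
  classical
  have : (ofCycles L).verts = (L.flatten.toFinset : Set V) := by
    ext v
    simp [ofCycles]
  rw [this, Set.ncard_coe_finset, List.toFinset_card_of_nodup hL, List.length_flatten]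

/-! ### The arcs of `J_{2m}^*` -/

/-- Translation of the vertices by `k` levels. -/
def shift (k : ℕ) : Vertex → Vertex
  | x i => x (k + i)
  | y i => y (k + i)

@[simp]
theorem index_shift (k : ℕ) (v : Vertex) : (shift k v).index = k + v.index := by
  cases v <;> rfl

theorem shift_injective (k : ℕ) : Function.Injective (shift k) := by
  rintro (i | i) (j | j) h <;> simp_all [shift]

theorem shift_shift (k l : ℕ) (v : Vertex) : shift k (shift l v) = shift (k + l) v := by
  cases v <;> simp [shift, Nat.add_assoc]

/-- The edges joining level `0` to the levels `1` and `2`, and the edge inside level `1`. -/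
def blockEdges : List (Vertex × Vertex) :=
  [(x 1, y 1), (x 0, x 1), (y 0, y 1), (x 0, y 1), (y 0, x 1), (x 0, x 2), (y 0, y 2),
    (x 0, y 2), (y 0, x 2)]

/-- The arcs obtained from `blockEdges`. -/
def blockArcs : List (Vertex × Vertex) := blockEdges ++ blockEdges.map Prod.swap

/-- The list of the arcs of `J_{2n}^*`. -/
def JArcs (n : ℕ) : List (Vertex × Vertex) :=
  (List.range n).flatMap fun i => blockArcs.map (Prod.map (shift i) (shift i))

theorem JArcs_add (p n : ℕ) :
    JArcs (p + n) = JArcs p ++ (JArcs n).map (Prod.map (shift p) (shift p)) := by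
  simp only [JArcs, List.range_add, List.flatMap_append, List.flatMap_map, List.map_flatMap,
    List.map_map]
  congr 2

theorem mem_JArcs {n : ℕ} {u v : Vertex} : (u, v) ∈ JArcs n ↔ (Jstar n).Arc u v := by
  simp only [JArcs, blockArcs, blockEdges, Jstar, JEdges, List.mem_flatMap, List.mem_range,
    Set.mem_union, Set.mem_ofPred_eq, List.map_append, List.map_cons, List.map_nil, List.mem_append,
    List.mem_cons, List.not_mem_nil, or_false, Prod.map, Prod.swap, shift, Prod.mk.injEq,
    Sym2.eq_iff]
  constructor
  · rintro ⟨i, hi, h⟩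
    -- Equal levels single out the edge `x y` of a block; in block `i` it lies in level `i + 1`,
    -- matching the range `1 ≤ i ≤ m` in `JEdges`.
    by_cases hl : u.index = v.index
    · refine Or.inl ⟨i + 1, by omega, by omega, ?_⟩
      rcases h with (⟨rfl, rfl⟩ | ⟨rfl, rfl⟩ | ⟨rfl, rfl⟩ | ⟨rfl, rfl⟩ | ⟨rfl, rfl⟩ | ⟨rfl, rfl⟩ |
        ⟨rfl, rfl⟩ | ⟨rfl, rfl⟩ | ⟨rfl, rfl⟩) | (⟨rfl, rfl⟩ | ⟨rfl, rfl⟩ | ⟨rfl, rfl⟩ |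
        ⟨rfl, rfl⟩ | ⟨rfl, rfl⟩ | ⟨rfl, rfl⟩ | ⟨rfl, rfl⟩ | ⟨rfl, rfl⟩ | ⟨rfl, rfl⟩) <;>
        simp [index] at hl ⊢
    · refine Or.inr ⟨i, hi, ?_⟩
      rcases h with (⟨rfl, rfl⟩ | ⟨rfl, rfl⟩ | ⟨rfl, rfl⟩ | ⟨rfl, rfl⟩ | ⟨rfl, rfl⟩ | ⟨rfl, rfl⟩ |
        ⟨rfl, rfl⟩ | ⟨rfl, rfl⟩ | ⟨rfl, rfl⟩) | (⟨rfl, rfl⟩ | ⟨rfl, rfl⟩ | ⟨rfl, rfl⟩ |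
        ⟨rfl, rfl⟩ | ⟨rfl, rfl⟩ | ⟨rfl, rfl⟩ | ⟨rfl, rfl⟩ | ⟨rfl, rfl⟩ | ⟨rfl, rfl⟩) <;>
        simp [index] at hl ⊢
  · rintro (⟨i, h1, h2, h⟩ | ⟨i, hi, h⟩)
    · obtain ⟨i, rfl⟩ := Nat.exists_eq_add_of_le' h1
      refine ⟨i, by omega, ?_⟩
      rcases h with ⟨rfl, rfl⟩ | ⟨rfl, rfl⟩ <;> simp
    · refine ⟨i, hi, ?_⟩
      rcases h with h | h | h | h | h | h | h | h <;>
        rcases h with ⟨rfl, rfl⟩ | ⟨rfl, rfl⟩ <;> simp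

theorem nodup_JArcs (n : ℕ) : (JArcs n).Nodup := by
  rw [JArcs, List.nodup_flatMap]
  refine ⟨fun i _ => (List.Nodup.map ((shift_injective i).prodMap (shift_injective i))
    (by decide)), List.nodup_range.imp ?_⟩
  intro i j hij e he he'
  obtain ⟨a, ha, rfl⟩ := List.mem_map.1 he
  obtain ⟨b, hb', h⟩ := List.mem_map.1 he'
  -- The two indices of an arc determine its block: the common level minus one if they agree, their
  -- minimum otherwise.
  have hd : ∀ e ∈ blockArcs, (e.1.index = 1 ∧ e.2.index = 1) ∨
      (min e.1.index e.2.index = 0 ∧ e.1.index ≠ e.2.index) := by decide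
  have h1 := congrArg (fun e : Vertex × Vertex => e.1.index) h
  have h2 := congrArg (fun e : Vertex × Vertex => e.2.index) h
  simp only [Prod.map, index_shift] at h1 h2
  have := hd a ha
  have := hd b hb'
  omega

/-! ### Decompositions cut into pieces -/

/-- The vertices of the levels `0` and `1`. -/
def corners : List Vertex := [x 0, x 1, y 0, y 1]

theorem mem_corners {v : Vertex} : v ∈ corners ↔ v.index ≤ 1 := by
  rcases v with i | i <;> simp [corners, index] <;> omega

/-- The external pattern `𝒳`, as lists of vertices. -/
def leftPattern : Fin 9 → List Vertex :=
  ![[y 1],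
    [x 0, x 1, y 1],
    [x 1, y 0, y 1],
    [x 0, x 1, y 0, y 1],
    [y 1],
    [x 0, x 1, y 0],
    [x 1, y 1],
    [x 1],
    [x 0, x 1, y 0, y 1]]

/-- The vertices of levels `0` and `1` on the right-hand side of the cut. -/
def cutPattern : Fin 9 → List Vertex :=
  ![[x 0, y 0, x 1, y 1],
    [x 0, y 0, x 1, y 1],
    [x 0, x 1, y 1],
    [x 0, x 1, y 1],
    [y 0, x 1, y 1],
    [x 0, x 1, y 1],
    [x 0, y 0, x 1, y 1],
    [y 0, x 1, y 1],
    [x 0, y 0, x 1, y 1]]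

/-- The vertices at which the long cycles cross the cut to the right. -/
def entry : Fin 9 → Vertex :=
  ![y 0, x 0, y 1, x 0, x 1, x 1, x 0, y 0, y 1]

/-- The vertices at which the long cycles cross the cut to the left. -/
def exit : Fin 9 → Vertex :=
  ![x 1, y 1, x 0, y 1, y 0, x 0, y 0, x 1, x 0]

/-- The parts of the long cycles to the left of the cut. -/
def leftPath : Fin 9 → List Vertex :=
  ![[y 1],
    [y 1, x 1, x 0],
    [x 1, y 0, y 2, y 1],
    [x 1, y 2, x 0, y 1, y 0],
    [x 2, y 1],
    [x 0, y 2, y 0, x 1],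
    [x 1, y 1],
    [x 1, x 2],
    [y 0, y 1, x 0, x 1]]

/-- The parts of the long cycles that run to the right in the periodic piece. -/
def upPath : Fin 9 → List Vertex :=
  ![[y 0, y 1, x 0],
    [x 0, x 1, y 0],
    [y 1],
    [x 0],
    [x 1, y 1],
    [x 1],
    [x 0, y 1, x 1],
    [y 0],
    [y 1, y 0, x 1]]

/-- The parts of the long cycles that run back to the left in the periodic piece. -/
def downPath : Fin 9 → List Vertex :=
  ![[x 1],
    [y 1],
    [y 2, x 1, x 0],
    [x 1, y 2, y 1],
    [x 2, y 0],
    [y 1, y 2, x 0],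
    [y 0],
    [y 1, x 2, x 1],
    [x 0]]

/-- The end paths on `2` levels for the type `[2s]`. -/
def endPathLong_2 : Fin 9 → List Vertex :=
  ![[y 0, y 2, x 0, x 2, y 1, x 3, x 1],
    [x 0, y 2, x 1, y 0, y 1],
    [y 1, x 1, x 2, x 0],
    [x 0, x 1, y 1],
    [x 1, x 3, y 1, y 2, x 2, y 0],
    [x 1, y 3, y 1, x 0],
    [x 0, y 1, x 2, x 1, y 2, y 0],
    [y 0, x 2, y 2, y 1, y 3, x 1],
    [y 1, y 0, x 1, x 0]]

/-- The end paths on `3` levels for the type `[2s]`. -/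
def endPathLong_3 : Fin 9 → List Vertex :=
  ![[y 0, x 2, x 4, y 2, x 3, y 3, y 1, x 0, x 1],
    [x 0, y 2, x 2, y 3, x 1, y 0, y 1],
    [y 1, x 3, x 2, y 2, x 1, x 0],
    [x 0, x 2, x 1, y 2, y 1],
    [x 1, y 3, y 2, x 4, x 2, x 3, y 1, y 0],
    [x 1, y 1, x 2, y 4, y 2, x 0],
    [x 0, y 1, x 1, x 3, y 2, y 3, x 2, y 0],
    [y 0, y 2, y 4, x 2, y 1, y 3, x 3, x 1],
    [y 1, y 2, y 0, x 1, x 2, x 0]]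

/-- The end paths on `3` levels for the type `[2s, 2]`. -/
def endPathTwo_3 : Fin 9 → List Vertex :=
  ![[y 0, x 2, x 4, y 2, y 3, x 3, x 1],
    [x 0, x 1, y 3, x 2, y 1],
    [y 1, x 1, y 2, x 0],
    [x 0, y 2, y 1],
    [x 1, x 3, y 2, x 4, x 2, y 0],
    [x 1, y 1, x 2, x 0],
    [x 0, x 2, y 3, y 2, x 1, y 0],
    [y 0, y 1, y 2, x 3, y 3, x 1],
    [y 1, y 0, x 1, x 0]]

/-- The short cycles on `3` levels for the type `[2s, 2]`. -/
def endCyclesTwo_3 : Fin 9 → List (List Vertex) :=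
  ![[[x 0, y 1]],
    [[y 0, y 2]],
    [[x 2, x 3]],
    [[x 1, x 2]],
    [[y 1, y 3]],
    [[y 2, y 4]],
    [[x 3, y 1]],
    [[x 2, y 4]],
    [[x 2, y 2]]]

/-- The end paths on `4` levels for the type `[2s, 2]`. -/
def endPathTwo_4 : Fin 9 → List Vertex :=
  ![[y 0, y 2, x 4, y 3, y 4, x 2, y 1, x 0, x 1],
    [x 0, y 2, x 3, x 2, y 4, y 3, y 1],
    [y 1, x 1, y 3, x 2, y 2, x 0],
    [x 0, x 2, x 1, y 2, y 1],
    [x 1, x 3, y 1, x 2, x 4, y 4, y 2, y 0],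
    [x 1, y 1, x 3, y 2, x 2, x 0],
    [x 0, y 1, y 3, x 4, y 2, x 1, x 2, y 0],
    [y 0, y 1, y 2, y 4, x 4, x 2, y 3, x 1],
    [y 1, y 0, x 2, x 3, x 1, x 0]]

/-- The short cycles on `4` levels for the type `[2s, 2]`. -/
def endCyclesTwo_4 : Fin 9 → List (List Vertex) :=
  ![[[x 3, x 5]],
    [[x 1, y 0]],
    [[x 3, x 4]],
    [[x 3, y 3]],
    [[x 5, y 3]],
    [[y 3, y 5]],
    [[x 3, y 4]],
    [[x 3, y 5]],
    [[y 2, y 3]]]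

/-- The end paths on `4` levels for the type `[2s, 2, 2]`. -/
def endPathTwoTwo_4 : Fin 9 → List Vertex :=
  ![[y 0, x 2, x 3, y 1, y 2, x 0, x 1],
    [x 0, x 2, x 1, y 0, y 1],
    [y 1, x 3, x 2, x 0],
    [x 0, y 2, y 1],
    [x 1, y 1, x 2, y 4, y 2, y 0],
    [x 1, x 2, y 1, x 0],
    [x 0, y 1, y 3, y 4, x 2, y 0],
    [y 0, y 2, y 4, y 3, y 1, x 1],
    [y 1, y 0, x 1, x 0]]

/-- The short cycles on `4` levels for the type `[2s, 2, 2]`. -/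
def endCyclesTwoTwo_4 : Fin 9 → List (List Vertex) :=
  ![[[x 4, y 4], [x 5, y 3]],
    [[x 3, y 4], [y 2, y 3]],
    [[x 1, y 3], [x 4, y 2]],
    [[x 1, x 3], [x 2, y 3]],
    [[x 3, x 5], [x 4, y 3]],
    [[x 3, y 2], [y 3, y 5]],
    [[x 1, y 2], [x 3, x 4]],
    [[x 2, x 4], [x 3, y 5]],
    [[x 2, y 2], [x 3, y 3]]]

/-- The end paths on `5` levels for the type `[2s, 2, 2]`. -/
def endPathTwoTwo_5 : Fin 9 → List Vertex :=
  ![[y 0, x 2, x 4, y 5, x 3, y 2, y 1, x 0, x 1],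
    [x 0, y 2, x 2, x 3, y 5, y 3, y 1],
    [y 1, x 2, y 3, x 3, x 1, x 0],
    [x 0, x 2, y 2, x 1, y 1],
    [x 1, x 3, x 2, y 1, y 3, y 4, y 2, y 0],
    [x 1, x 2, y 4, y 3, y 2, x 0],
    [x 0, y 1, x 1, y 2, x 3, y 3, x 2, y 0],
    [y 0, y 1, y 2, y 3, y 5, x 4, x 2, x 1],
    [y 1, y 0, y 2, y 4, x 2, x 0]]

/-- The short cycles on `5` levels for the type `[2s, 2, 2]`. -/
def endCyclesTwoTwo_5 : Fin 9 → List (List Vertex) :=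
  ![[[x 5, y 3], [x 6, y 4]],
    [[x 1, y 0], [x 4, y 4]],
    [[x 4, y 2], [x 5, y 4]],
    [[x 3, y 4], [x 4, y 3]],
    [[x 4, x 6], [x 5, y 5]],
    [[x 3, y 1], [x 4, y 6]],
    [[x 4, x 5], [y 4, y 5]],
    [[x 3, x 5], [y 4, y 6]],
    [[x 1, y 3], [x 3, x 4]]]

/-- The end paths on `5` levels for the type `[2s, 4]`. -/
def endPathFour_5 : Fin 9 → List Vertex :=
  ![[y 0, y 2, x 0, y 1, x 2, x 3, x 5, y 3, x 1],
    [x 0, x 1, y 3, x 3, y 2, y 0, y 1],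
    [y 1, y 3, y 2, x 1, x 2, x 0],
    [x 0, y 2, x 2, x 1, y 1],
    [x 1, x 3, y 5, y 3, x 2, y 2, y 1, y 0],
    [x 1, y 2, x 3, y 3, y 1, x 0],
    [x 0, x 2, y 1, y 2, y 4, x 3, x 1, y 0],
    [y 0, x 2, y 3, x 5, y 5, x 3, y 1, x 1],
    [y 1, x 3, x 2, y 0, x 1, x 0]]

/-- The short cycles on `5` levels for the type `[2s, 4]`. -/
def endCyclesFour_5 : Fin 9 → List (List Vertex) :=
  ![[[x 4, x 6, y 4, y 5]],
    [[x 2, x 4, y 5, y 4]],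
    [[x 3, x 4, y 4, x 5]],
    [[x 3, y 4, y 3, x 4]],
    [[x 4, x 5, y 4, x 6]],
    [[x 2, y 4, y 6, x 4]],
    [[x 4, y 3, y 5, x 5]],
    [[x 4, y 6, y 4, y 2]],
    [[x 4, y 2, y 3, y 4]]]

/-- The end paths on `6` levels for the type `[2s, 4]`. -/
def endPathFour_6 : Fin 9 → List Vertex :=
  ![[y 0, y 1, y 3, x 5, x 7, y 5, y 6, x 6, x 4, x 3, x 1],
    [x 0, y 2, x 2, y 0, x 1, x 3, y 5, y 3, y 1],
    [y 1, y 2, x 4, y 3, x 3, x 2, x 1, x 0],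
    [x 0, x 1, y 3, y 5, x 5, x 3, y 1],
    [x 1, y 1, x 3, x 4, y 6, y 4, y 3, x 2, y 2, y 0],
    [x 1, y 2, y 3, y 4, x 4, x 2, y 1, x 0],
    [x 0, y 1, x 2, x 3, y 4, x 5, y 3, y 2, x 1, y 0],
    [y 0, x 2, y 3, x 4, x 6, y 4, x 3, y 2, y 1, x 1],
    [y 1, y 0, y 2, x 3, y 3, x 1, x 2, x 0]]

/-- The short cycles on `6` levels for the type `[2s, 4]`. -/
def endCyclesFour_6 : Fin 9 → List (List Vertex) :=
  ![[[x 0, x 2, y 4, y 2]],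
    [[x 4, y 4, y 6, x 5]],
    [[x 5, y 5, y 4, x 6]],
    [[x 2, x 4, y 2, y 4]],
    [[x 5, x 6, y 5, x 7]],
    [[x 3, x 5, y 7, y 5]],
    [[x 4, y 5, x 6, y 6]],
    [[x 5, y 6, y 5, y 7]],
    [[x 4, x 5, y 4, y 5]]]

/-- The paths `R i` from `entry i` to `exit i` and the short cycles `Z i`, of lengths `F`, form the
part of a decomposition of `J_{2(n + 2)}^*` to the right of a cut after the first two levels,
translated to the left by two levels. -/
structure IsEnd (n : ℕ) (F : List ℕ) (R : Fin 9 → List Vertex) (Z : Fin 9 → List (List Vertex)) :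
    Prop where
  two_le : 2 ≤ n
  perm : ((List.finRange 9).flatMap fun i => pathArcs (R i) ++ (Z i).flatMap cycleArcs).Perm
    (JArcs n)
  nodup : ∀ i, (R i ++ (Z i).flatten).Nodup
  index_le : ∀ i, ∀ v ∈ R i ++ (Z i).flatten, v.index ≤ n + 1
  mem_left : ∀ i, ∀ v ∈ corners, v ∈ R i ++ (Z i).flatten ↔ v ∈ cutPattern i
  mem_right : ∀ i, ∀ v ∈ corners, shift n v ∈ R i ++ (Z i).flatten ↔ v ∉ leftPattern i
  head : ∀ i, (R i).head? = some (entry i)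
  getLast : ∀ i, (R i).getLast? = some (exit i)
  length_path : ∀ i, (R i).length + (leftPath i).length + F.sum = 2 * (n + 2)
  length_cycles : ∀ i, (Z i).map List.length = F

/-- Two neighbouring pieces share only the translates of the corners, and there `s` (the cut
pattern) decides which side owns a vertex. -/
theorem disjoint_shift {p : ℕ} {l r s : List Vertex} (hl : ∀ v ∈ l, v.index ≤ p + 1)
    (hr : ∀ v ∈ corners, v ∈ r → v ∈ s) (hs : ∀ v ∈ corners, shift p v ∈ l → v ∉ s) :
    l.Disjoint (r.map (shift p)) := by
  intro v hv hv'
  obtain ⟨w, hw, rfl⟩ := List.mem_map.1 hv'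
  have h := hl _ hv
  rw [index_shift] at h
  have hc : w ∈ corners := mem_corners.2 (by omega)
  exact hs w hc hv (hr w hc hw)

/-- The rest of a path sees an inner segment only through its first and last vertices, so a segment
can be replaced by any other with the same ends. -/
theorem pathArcs_between {V : Type*} {r : List V} {a b : V} (ha : r.head? = some a)
    (hb : r.getLast? = some b) (l l' : List V) :
    pathArcs (l ++ r ++ l') = pathArcs (l ++ [a]) ++ pathArcs r ++ pathArcs (b :: l') := by
  obtain ⟨t, rfl⟩ := List.head?_eq_some_iff.1 ha
  obtain ⟨t', ht⟩ := List.getLast?_eq_some_iff.1 hb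
  rw [List.append_assoc, List.cons_append, pathArcs_append_cons, List.append_assoc,
    ← List.cons_append, ht, List.append_assoc, List.singleton_append, pathArcs_append_cons t' b l']

theorem flatMap_perm_append {α β : Type*} (l : List α) (f g h : α → List β)
    (H : ∀ a ∈ l, (f a).Perm (g a ++ h a)) : (l.flatMap f).Perm (l.flatMap g ++ l.flatMap h) :=
  (List.Perm.flatMap_left l H).trans (List.flatMap_append_perm l g h).symm

/-! #### The periodic piece -/

/-- The 36 arcs of two levels are used up by nine paths from an entry to the next entry and nine
paths from the next exit back to the exit. -/
theorem periodic_perm : ((List.finRange 9).flatMap fun i =>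
    pathArcs (upPath i ++ [shift 2 (entry i)]) ++ pathArcs (shift 2 (exit i) :: downPath i)).Perm
      (JArcs 2) := by decide +kernel

theorem periodic_nodup : ∀ i, (upPath i ++ downPath i).Nodup := by decide +kernel

theorem periodic_index_le : ∀ i, ∀ v ∈ upPath i ++ downPath i, v.index ≤ 3 := by decide +kernel

theorem periodic_mem_left : ∀ i, ∀ v ∈ corners,
    v ∈ upPath i ++ downPath i ↔ v ∈ cutPattern i := by decide +kernel

theorem periodic_mem_right : ∀ i, ∀ v ∈ corners,
    shift 2 v ∈ upPath i ++ downPath i → v ∉ cutPattern i := by decide +kernel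

theorem periodic_head : ∀ i, (upPath i).head? = some (entry i) := by decide +kernel

theorem periodic_getLast : ∀ i, (downPath i).getLast? = some (exit i) := by decide +kernel

theorem periodic_length : ∀ i, (upPath i).length + (downPath i).length = 4 := by decide +kernel

/-- Inserting a periodic piece on the left of an end piece gives an end piece again: its left
boundary data are those of the periodic piece, its right boundary data and short cycles those of the
old end piece. -/
theorem IsEnd.extend {n : ℕ} {F : List ℕ} {R : Fin 9 → List Vertex}
    {Z : Fin 9 → List (List Vertex)} (h : IsEnd n F R Z) :
    IsEnd (n + 2) F (fun i => upPath i ++ (R i).map (shift 2) ++ downPath i)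
      (fun i => (Z i).map (List.map (shift 2))) := by
  have hperm (i : Fin 9) : (upPath i ++ (R i).map (shift 2) ++ downPath i ++
      ((Z i).map (List.map (shift 2))).flatten).Perm
      ((upPath i ++ downPath i) ++ (R i ++ (Z i).flatten).map (shift 2)) := by
    rw [List.map_append, List.map_flatten]
    simp only [List.append_assoc]
    refine List.Perm.append_left _ ?_
    simp only [← List.append_assoc]
    exact List.Perm.append_right _ List.perm_append_comm
  have hmem (i : Fin 9) (v : Vertex) : v ∈ upPath i ++ (R i).map (shift 2) ++ downPath i ++
      ((Z i).map (List.map (shift 2))).flatten ↔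
      v ∈ upPath i ++ downPath i ∨ v ∈ (R i ++ (Z i).flatten).map (shift 2) := by
    rw [(hperm i).mem_iff, List.mem_append]
  refine ⟨by have := h.two_le; omega, ?_, ?_, ?_, ?_, ?_, ?_, ?_, ?_, ?_⟩
  · rw [Nat.add_comm, JArcs_add]
    refine (flatMap_perm_append _ _ (fun i => pathArcs (upPath i ++ [shift 2 (entry i)]) ++
      pathArcs (shift 2 (exit i) :: downPath i)) (fun i => (pathArcs (R i) ++
      (Z i).flatMap cycleArcs).map (Prod.map (shift 2) (shift 2))) fun i _ => ?_).trans
      (periodic_perm.append ?_)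
    · rw [pathArcs_between (a := shift 2 (entry i)) (b := shift 2 (exit i))
        (by simp [h.head]) (by simp [h.getLast]), pathArcs_map, List.flatMap_map,
        List.map_append, List.map_flatMap]
      simp only [cycleArcs_map, List.append_assoc]
      refine List.Perm.append_left _ ?_
      simp only [← List.append_assoc]
      exact List.Perm.append_right _ List.perm_append_comm
    · rw [← List.map_flatMap]
      exact h.perm.map _
  · intro i
    rw [(hperm i).nodup_iff]
    exact (periodic_nodup i).append ((h.nodup i).map (shift_injective 2))
      (disjoint_shift (periodic_index_le i) (fun v hv => (h.mem_left i v hv).1)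
        (periodic_mem_right i))
  · intro i v hv
    rcases (hmem i v).1 hv with hv | hv
    · have := periodic_index_le i v hv
      omega
    · obtain ⟨w, hw, rfl⟩ := List.mem_map.1 hv
      have := h.index_le i w hw
      rw [index_shift]
      omega
  · intro i v hv
    rw [hmem, ← periodic_mem_left i v hv, or_iff_left]
    intro hv'
    obtain ⟨w, hw, rfl⟩ := List.mem_map.1 hv'
    have := mem_corners.1 hv
    rw [index_shift] at this
    omega
  · intro i v hv
    rw [hmem, ← h.mem_right i v hv, or_iff_right, Nat.add_comm, ← shift_shift,
      List.mem_map_of_injective (shift_injective 2)]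
    intro hv'
    have h1 := periodic_index_le i _ hv'
    -- The last two levels are at least `n + 2 ≥ 4`, out of reach of the periodic piece, which stops
    -- at level 3.
    have h2 := h.two_le
    rw [index_shift] at h1
    omega
  · intro i
    simp [periodic_head]
  · intro i
    simp [periodic_getLast]
  · intro i
    have h1 := periodic_length i
    have h2 := h.length_path i
    simp only [List.length_append, List.length_map]
    omega
  · intro i
    simp [← h.length_cycles i, Function.comp_def]

theorem IsEnd.exists_extend {n : ℕ} {F : List ℕ} {R : Fin 9 → List Vertex}
    {Z : Fin 9 → List (List Vertex)} (h : IsEnd n F R Z) (k : ℕ) :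
    ∃ R' Z', IsEnd (n + 2 * k) F R' Z' := by
  induction k with
  | zero => exact ⟨R, Z, h⟩
  | succ k ih =>
    obtain ⟨R', Z', h'⟩ := ih
    exact ⟨_, _, h'.extend⟩

/-! #### The left piece -/

/-- The left piece carries no short cycle: its arcs form nine paths from the exit of the cut to its
entry, each closing up one long cycle. -/
theorem left_perm : ((List.finRange 9).flatMap fun i =>
    pathArcs (shift 2 (exit i) :: (leftPath i ++ [shift 2 (entry i)]))).Perm (JArcs 2) := by
  decide +kernel

theorem left_nodup : ∀ i, (leftPath i).Nodup := by decide +kernel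

theorem left_index_le : ∀ i, ∀ v ∈ leftPath i, v.index ≤ 3 := by decide +kernel

theorem left_mem_left : ∀ i, ∀ v ∈ corners, v ∈ leftPath i ↔ v ∈ leftPattern i := by
  decide +kernel

theorem left_mem_right : ∀ i, ∀ v ∈ corners, shift 2 v ∈ leftPath i → v ∉ cutPattern i := by
  decide +kernel

theorem patternX_eq (i : Fin 9) : patternX i = {v | v ∈ leftPattern i} := by
  fin_cases i <;> ext v <;> simp [patternX, leftPattern]

theorem leftPattern_subset : ∀ i, ∀ v ∈ leftPattern i, v ∈ corners := by decide +kernel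

theorem IsEnd.exists_decomposition {n : ℕ} {F : List ℕ} {R : Fin 9 → List Vertex}
    {Z : Fin 9 → List (List Vertex)} (h : IsEnd n F R Z) {a : ℕ}
    (ha : a + F.sum = 2 * (n + 2)) (ha' : 2 ≤ a) (hF : ∀ k ∈ F, 2 ≤ k) :
    ∃ D : Fin 9 → VDigraph Vertex,
      IsAdmissibleDecomposition (n + 2) (a :: F) D ∧ externalPattern D = patternX := by
  let C (i : Fin 9) : List (List Vertex) :=
    ((R i).map (shift 2) ++ leftPath i) :: (Z i).map (List.map (shift 2))
  have hperm (i : Fin 9) : (C i).flatten.Perm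
      (leftPath i ++ (R i ++ (Z i).flatten).map (shift 2)) := by
    rw [List.map_append, List.map_flatten]
    simp only [C, List.flatten_cons, ← List.append_assoc]
    exact List.Perm.append_right _ List.perm_append_comm
  have hmem (i : Fin 9) (v : Vertex) : v ∈ (ofCycles (C i)).verts ↔
      v ∈ leftPath i ∨ v ∈ (R i ++ (Z i).flatten).map (shift 2) := by
    rw [← List.mem_append, ← (hperm i).mem_iff]
    rfl
  have hnodup (i : Fin 9) : (C i).flatten.Nodup := by
    rw [(hperm i).nodup_iff]
    exact (left_nodup i).append ((h.nodup i).map (shift_injective 2))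
      (disjoint_shift (left_index_le i) (fun v hv => (h.mem_left i v hv).1) (left_mem_right i))
  have hlen (i : Fin 9) : (C i).map List.length = a :: F := by
    have h1 := h.length_path i
    simp only [C, List.map_cons, List.length_append, List.length_map, List.map_map,
      List.cons.injEq]
    exact ⟨by omega, by simp [← h.length_cycles i, Function.comp_def]⟩
  have hleft (i : Fin 9) (v : Vertex) (hv : v ∈ corners) :
      v ∈ (ofCycles (C i)).verts ↔ v ∈ leftPattern i := by
    rw [hmem, ← left_mem_left i v hv, or_iff_left]
    intro hv'
    obtain ⟨w, hw, rfl⟩ := List.mem_map.1 hv'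
    have := mem_corners.1 hv
    rw [index_shift] at this
    omega
  have hright (i : Fin 9) (v : Vertex) (hv : v ∈ corners) :
      shift (n + 2) v ∈ (ofCycles (C i)).verts ↔ v ∉ leftPattern i := by
    rw [hmem, ← h.mem_right i v hv, or_iff_right, Nat.add_comm, ← shift_shift,
      List.mem_map_of_injective (shift_injective 2)]
    intro hv'
    have h1 := left_index_le i _ hv'
    have h2 := h.two_le
    rw [index_shift] at h1
    omega
  -- With `m = n + 2`, translation by `m` carries each corner to its partner in the definition of
  -- admissibility, and the end piece uses the partner exactly when the corner is absent.
  have hxor (i : Fin 9) (v : Vertex) (hv : v ∈ corners) :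
      Xor (v ∈ (ofCycles (C i)).verts) (shift (n + 2) v ∈ (ofCycles (C i)).verts) := by
    rw [hleft i v hv, hright i v hv]
    exact xor_not_right.2 Iff.rfl
  -- This single permutation gives both halves of the decomposition property: equal membership gives
  -- the union, and `nodup_JArcs` gives arc-disjointness.
  have harcs : ((List.finRange 9).flatMap fun i => (C i).flatMap cycleArcs).Perm
      (JArcs (n + 2)) := by
    rw [Nat.add_comm, JArcs_add]
    refine (flatMap_perm_append _ _ (fun i => pathArcs (shift 2 (exit i) ::
      (leftPath i ++ [shift 2 (entry i)]))) (fun i => (pathArcs (R i) ++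
      (Z i).flatMap cycleArcs).map (Prod.map (shift 2) (shift 2))) fun i _ => ?_).trans
      (left_perm.append ?_)
    -- The long cycle is listed from its entry vertex; repeating that vertex at the end turns the
    -- cycle into a path, which is then cut at the exit.
    · have hc : cycleArcs ((R i).map (shift 2) ++ leftPath i) =
          (pathArcs (R i)).map (Prod.map (shift 2) (shift 2)) ++
            pathArcs (shift 2 (exit i) :: (leftPath i ++ [shift 2 (entry i)])) := by
        have h1 := pathArcs_between (r := (R i).map (shift 2)) (a := shift 2 (entry i))
          (b := shift 2 (exit i)) (by simp [h.head]) (by simp [h.getLast]) []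
          (leftPath i ++ [shift 2 (entry i)])
        obtain ⟨t, ht⟩ := List.head?_eq_some_iff.1 (h.head i)
        rw [← pathArcs_map]
        simp only [ht, List.map_cons, List.cons_append, List.nil_append] at h1 ⊢
        rw [cycleArcs_cons]
        simpa [pathArcs] using h1
      simp only [C, List.flatMap_cons, List.flatMap_map, List.map_append, List.map_flatMap, hc,
        cycleArcs_map, ← List.append_assoc]
      exact List.Perm.append_right _ List.perm_append_comm
    · rw [← List.map_flatMap]
      exact h.perm.map _
  have harc (i : Fin 9) (u v : Vertex) :
      (ofCycles (C i)).Arc u v ↔ (u, v) ∈ (C i).flatMap cycleArcs := Iff.rfl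
  have hunion (u v : Vertex) : (Jstar (n + 2)).Arc u v ↔ ∃ i, (ofCycles (C i)).Arc u v := by
    rw [← mem_JArcs, ← harcs.mem_iff]
    simp only [List.mem_flatMap, List.mem_finRange, true_and, harc]
  have hsub (i : Fin 9) : (ofCycles (C i)).IsSubdigraph (Jstar (n + 2)) := by
    refine ⟨fun v hv => ?_, fun u v huv => (hunion u v).2 ⟨i, huv⟩⟩
    change v.index ≤ n + 2 + 1
    rcases (hmem i v).1 hv with hv | hv
    · have := left_index_le i v hv
      omega
    · obtain ⟨w, hw, rfl⟩ := List.mem_map.1 hv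
      have := h.index_le i w hw
      rw [index_shift]
      omega
  have htype (i : Fin 9) : (ofCycles (C i)).IsOfType (a :: F) :=
    ofCycles_isOfType (hlen i) (hnodup i)
  refine ⟨fun i => ofCycles (C i), ⟨⟨hsub, ?_, hunion⟩, fun i => ⟨hsub i, ⟨_, ?_, htype i⟩, ?_,
    ?_, ?_, ?_, ?_⟩, htype⟩, ?_⟩
  · rintro i j hij u v ⟨hi, hj⟩
    have hd := (List.nodup_flatMap.1 (harcs.nodup_iff.2 (nodup_JArcs _))).2
    have hd' : ∀ i j : Fin 9, i < j → ((C i).flatMap cycleArcs).Disjoint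
        ((C j).flatMap cycleArcs) := fun i j hij => by
      have := List.pairwise_iff_getElem.1 hd i j (by simp) (by simp) hij
      simpa [Function.onFun] using this
    rcases lt_or_gt_of_ne hij with hlt | hlt
    · exact hd' i j hlt hi hj
    · exact hd' j i hlt hj hi
  · simpa using ⟨ha', hF⟩
  · rw [ncard_verts_ofCycles (hnodup i), hlen, List.sum_cons, ha]
  · simpa [shift] using hxor i (x 0) (by decide)
  · simpa [shift] using hxor i (x 1) (by decide)
  · simpa [shift] using hxor i (y 0) (by decide)
  · simpa [shift] using hxor i (y 1) (by decide)
  · funext i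
    rw [patternX_eq]
    ext v
    have hcor : v ∈ ({x 0, x 1, y 0, y 1} : Set Vertex) ↔ v ∈ corners := by simp [corners]
    change v ∈ ({x 0, x 1, y 0, y 1} : Set Vertex) ∧ v ∈ (ofCycles (C i)).verts ↔
      v ∈ leftPattern i
    rw [hcor]
    exact ⟨fun hv => (hleft i v hv.1).1 hv.2, fun hv =>
      ⟨leftPattern_subset i v hv, (hleft i v (leftPattern_subset i v hv)).2 hv⟩⟩

/-! #### The end pieces -/

theorem isEndLong_2 : IsEnd 2 [] endPathLong_2
    (fun _ => []) :=
  ⟨by decide, by decide +kernel, by decide +kernel, by decide +kernel, by decide +kernel,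
    by decide +kernel, by decide +kernel, by decide +kernel, by decide +kernel,
    by decide +kernel⟩

theorem isEndLong_3 : IsEnd 3 [] endPathLong_3
    (fun _ => []) :=
  ⟨by decide, by decide +kernel, by decide +kernel, by decide +kernel, by decide +kernel,
    by decide +kernel, by decide +kernel, by decide +kernel, by decide +kernel,
    by decide +kernel⟩

theorem isEndTwo_3 : IsEnd 3 [2] endPathTwo_3
    endCyclesTwo_3 :=
  ⟨by decide, by decide +kernel, by decide +kernel, by decide +kernel, by decide +kernel,
    by decide +kernel, by decide +kernel, by decide +kernel, by decide +kernel,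
    by decide +kernel⟩

theorem isEndTwo_4 : IsEnd 4 [2] endPathTwo_4
    endCyclesTwo_4 :=
  ⟨by decide, by decide +kernel, by decide +kernel, by decide +kernel, by decide +kernel,
    by decide +kernel, by decide +kernel, by decide +kernel, by decide +kernel,
    by decide +kernel⟩

theorem isEndTwoTwo_4 : IsEnd 4 [2, 2] endPathTwoTwo_4
    endCyclesTwoTwo_4 :=
  ⟨by decide, by decide +kernel, by decide +kernel, by decide +kernel, by decide +kernel,
    by decide +kernel, by decide +kernel, by decide +kernel, by decide +kernel,
    by decide +kernel⟩

theorem isEndTwoTwo_5 : IsEnd 5 [2, 2] endPathTwoTwo_5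
    endCyclesTwoTwo_5 :=
  ⟨by decide, by decide +kernel, by decide +kernel, by decide +kernel, by decide +kernel,
    by decide +kernel, by decide +kernel, by decide +kernel, by decide +kernel,
    by decide +kernel⟩

theorem isEndFour_5 : IsEnd 5 [4] endPathFour_5
    endCyclesFour_5 :=
  ⟨by decide, by decide +kernel, by decide +kernel, by decide +kernel, by decide +kernel,
    by decide +kernel, by decide +kernel, by decide +kernel, by decide +kernel,
    by decide +kernel⟩

theorem isEndFour_6 : IsEnd 6 [4] endPathFour_6
    endCyclesFour_6 :=
  ⟨by decide, by decide +kernel, by decide +kernel, by decide +kernel, by decide +kernel,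
    by decide +kernel, by decide +kernel, by decide +kernel, by decide +kernel,
    by decide +kernel⟩

/-- Periodic pieces change the number of levels by two, so end pieces with consecutive numbers of
levels reach every `m ≥ n + 2`. -/
theorem exists_decomposition_of_isEnd {n : ℕ} {F : List ℕ} {R R' : Fin 9 → List Vertex}
    {Z Z' : Fin 9 → List (List Vertex)} (h : IsEnd n F R Z) (h' : IsEnd (n + 1) F R' Z')
    (hF : ∀ k ∈ F, 2 ≤ k) {m a : ℕ} (hm : n + 2 ≤ m) (ha : a + F.sum = 2 * m) (ha' : 2 ≤ a) :
    ∃ D : Fin 9 → VDigraph Vertex,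
      IsAdmissibleDecomposition m (a :: F) D ∧ externalPattern D = patternX := by
  rcases Nat.even_or_odd' (m - (n + 2)) with ⟨k, hk | hk⟩
  · obtain ⟨_, _, hk'⟩ := h.exists_extend k
    obtain rfl : m = n + 2 * k + 2 := by omega
    exact hk'.exists_decomposition ha ha' hF
  · obtain ⟨_, _, hk'⟩ := h'.exists_extend k
    obtain rfl : m = n + 1 + 2 * k + 2 := by omega
    exact hk'.exists_decomposition ha ha' hF

end DirectedOberwolfach

theorem mainTheorem7 (m : ℕ) (F : List ℕ) (hF : F.sum = 2 * m)
    (hcases : (∃ s : ℕ, 4 ≤ s ∧ F = [2 * s]) ∨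
      (∃ s : ℕ, 4 ≤ s ∧ F = [2 * s, 2]) ∨
      (∃ s : ℕ, 4 ≤ s ∧ F = [2 * s, 2, 2]) ∨
      (∃ s : ℕ, 5 ≤ s ∧ F = [2 * s, 4])) :
    ∃ D : Fin 9 → DirectedOberwolfach.VDigraph DirectedOberwolfach.Vertex,
      DirectedOberwolfach.IsAdmissibleDecomposition m F D ∧
      DirectedOberwolfach.externalPattern D = DirectedOberwolfach.patternX := by
  open DirectedOberwolfach in
  rcases hcases with ⟨s, hs, rfl⟩ | ⟨s, hs, rfl⟩ | ⟨s, hs, rfl⟩ | ⟨s, hs, rfl⟩ <;>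
    simp only [List.sum_cons, List.sum_nil] at hF
  -- In the four cases `m` is `s`, `s + 1`, `s + 2`, `s + 2`, so the bounds on `s` give `m ≥ 4, 5,
  -- 6, 7`: two more than the 2, 3, 4, 5 levels of the smaller end piece.
  · exact exists_decomposition_of_isEnd isEndLong_2 isEndLong_3 (by simp) (by omega)
      (by simpa using hF) (by omega)
  · exact exists_decomposition_of_isEnd isEndTwo_3 isEndTwo_4 (by simp) (by omega)
      (by simpa using hF) (by omega)
  · exact exists_decomposition_of_isEnd isEndTwoTwo_4 isEndTwoTwo_5 (by simp) (by omega)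
      (by simpa using hF) (by omega)
  · exact exists_decomposition_of_isEnd isEndFour_5 isEndFour_6 (by simp) (by omega)
      (by simpa using hF) (by omega)
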